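/- Let $\beta=(\beta_w)_{|w|\le 4}$ be a real sequence indexed by the words of length at most $4$ in two noncommuting letters $X,Y$, with $\beta_v=\beta_w$ whenever $v$ is a cyclic permutation of $w$ and $\beta_{w^*}=\beta_w$, where $w^*$ is the reversed word. Let $\mathcal M_2=(\beta_{U^*V})_{|U|,|V|\le 2}$ be its $7\times 7$ moment matrix, with columns $\mathbf 1,\mathbb X,\mathbb Y,\mathbb X^2,\mathbb X\mathbb Y,\mathbb Y\mathbb X,\mathbb Y^2$. A representing measure of $\beta$ consists of finitely many atoms $(A_i,B_i)$, pairs of real symmetric $t_i\times t_i$ matrices ($t_i\ge 1$), with densities $\lambda_i>0$, $\sum_i\lambda_i=1$, such that $\beta_w=\sum_i\lambda_i\,\tfrac1{t_i}\operatorname{tr}(w(A_i,B_i))$ for all $|w|\le 4$. It is of type $(m_1,\dots,m_r)$ if it has exactly $m_k$ atoms of size $k$ for $k\le r$, none of larger size, and $m_r\ne 0$. It is minimal if no representing measure of $\beta$ has a type $(m_1',\dots,m_{r'}')$ with $r'<r$, or with $r'=r$ and $m'_k<m_k$ for the largest $k$ with $m'_k\neq m_k$. The sequence $\beta$ admits an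 nc measure if it has a minimal representing measure of a type with $r>1$. Two measures are orthogonally equivalent if, after a renumbering of the atoms, they have the same densities and each atom $(A_i,B_i)$ of the first corresponds to an atom $(UA_iU^t,UB_iU^t)$ of the second with $U=U_i$ an orthogonal matrix. Suppose that $\beta_1=1$, $\beta_{X^2Y^2}\ne\beta_{XYXY}$, $\operatorname{rank}\mathcal M_2=5$, and that the columns of $\mathcal M_2$ satisfy $\mathbb X\mathbb Y+\mathbb Y\mathbb X=\mathbf 0$ and $\mathbb Y^2=\mathbf 1$. Then $\beta$ admits an nc measure if and only if one of the following holds: 1. $\mathcal M_2$ is positive semidefinite and $\beta_{X^3}=\beta_Y=0$; 2. $\mathcal M_2$ is positive semidefinite and $$\beta_{X^3}=0,\quad \beta_{X^2}>0,\quad 0<|\beta_Y|<1,\quad \beta_{X^4}\ge\frac{\beta_{X^2}^2}{1-|\beta_Y|}.\qquad(\ast)$$ In case 1 the minimal representing measure exists, is unique up to orthogonal equivalence, and is of type $(2,1)$. If $(\ast)$ holds, the minimal representing measure exists and is unique up to orthogonal equivalence; it is of type $(1,1)$ if and only if $\beta_{X^4}=\beta_{X^2}^2/(1-|\beta_Y|)$,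 and otherwise of type $(2,1)$. -/

import Mathlib

namespace TracialMoment

/-- The two noncommuting letters. Words in `X, Y` are lists of letters. -/
inductive Letter : Type
  | X
  | Y

/-- A sequence of real numbers indexed by the words in `X, Y` of length at most `4`, invariant under
cyclic permutation and under reversal of words. -/
structure TracialSequence where
  toFun : {w : List Letter // w.length ≤ 4} → ℝ
  cyclic : ∀ v w : {w : List Letter // w.length ≤ 4}, v.1.IsRotated w.1 → toFun v = toFun w
  reversal : ∀ v w : {w : List Letter // w.length ≤ 4}, w.1 = v.1.reverse → toFun v = toFun w

/-- The entry `β_w`. -/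
def TracialSequence.moment (β : TracialSequence) (w : List Letter)
    (hw : w.length ≤ 4 := by simp) : ℝ :=
  β.toFun ⟨w, hw⟩

/-- `β_1 = 1`. -/
def TracialSequence.IsNormalized (β : TracialSequence) : Prop :=
  β.moment [] = 1

/-- `β_{X²Y²} ≠ β_{XYXY}`. -/
def TracialSequence.IsNoncommutative (β : TracialSequence) : Prop :=
  β.moment [.X, .X, .Y, .Y] ≠ β.moment [.X, .Y, .X, .Y]

/-- The words of length at most `2` in degree-lexicographic order:
`1, X, Y, X², XY, YX, Y²`. -/
def wordsTwo : Fin 7 → List Letter :=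
  ![[], [.X], [.Y], [.X, .X], [.X, .Y], [.Y, .X], [.Y, .Y]]

theorem length_wordsTwo_le (i : Fin 7) : (wordsTwo i).length ≤ 2 := by
  fin_cases i <;> simp [wordsTwo]

theorem length_reverse_append_le (i : Fin 7) {w : List Letter} (hw : w.length ≤ 2) :
    ((wordsTwo i).reverse ++ w).length ≤ 4 := by
  have h := length_wordsTwo_le i
  simp only [List.length_append, List.length_reverse]
  omega

/-- The column of the moment matrix indexed by the word `w`; its entry in the row `U` is
`β_{U* w}`. -/
def TracialSequence.column (β : TracialSequence) (w : List Letter)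
    (hw : w.length ≤ 2 := by simp) : Fin 7 → ℝ :=
  fun i => β.moment ((wordsTwo i).reverse ++ w) (length_reverse_append_le i hw)

/-- The truncated moment matrix of order `2`, with entry `β_{U* V}` in row `U` and column `V`. -/
def TracialSequence.momentMatrix (β : TracialSequence) : Matrix (Fin 7) (Fin 7) ℝ :=
  Matrix.of fun i j => β.column (wordsTwo j) (length_wordsTwo_le j) i

/-- The value `w(A, B)` of a word at a pair of square matrices. -/
def evalWord {t : ℕ} (A B : Matrix (Fin t) (Fin t) ℝ) (w : List Letter) :
    Matrix (Fin t) (Fin t) ℝ :=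
  (w.map fun l => match l with
    | .X => A
    | .Y => B).prod

/-- Finitely many pairs of real symmetric matrices (the atoms) with positive densities of
sum `1`. -/
structure AtomicMeasure where
  N : ℕ
  size : Fin N → ℕ
  size_pos : ∀ i, 0 < size i
  density : Fin N → ℝ
  density_pos : ∀ i, 0 < density i
  density_sum : ∑ i, density i = 1
  A : (i : Fin N) → Matrix (Fin (size i)) (Fin (size i)) ℝ
  B : (i : Fin N) → Matrix (Fin (size i)) (Fin (size i)) ℝ
  A_symm : ∀ i, (A i).IsSymm
  B_symm : ∀ i, (B i).IsSymm

/-- `β_w = ∑ i, λ_i Tr (w(A_i, B_i))` for all words `w` of length at most `4`, with the normalized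
trace `Tr`. -/
def AtomicMeasure.Represents (μ : AtomicMeasure) (β : TracialSequence) : Prop :=
  ∀ (w : List Letter) (hw : w.length ≤ 4),
    β.moment w hw =
      ∑ i, μ.density i * ((1 / (μ.size i : ℝ)) * (evalWord (μ.A i) (μ.B i) w).trace)

/-- The number of atoms of size `k`. -/
def AtomicMeasure.count (μ : AtomicMeasure) (k : ℕ) : ℕ :=
  (Finset.univ.filter fun i => μ.size i = k).card

/-- The largest size of an atom. -/
def AtomicMeasure.maxSize (μ : AtomicMeasure) : ℕ :=
  Finset.univ.sup μ.size

/-- The measure is of type `(m_1, …, m_r)`: there are exactly `m_k` atoms of size `k`, and `r` is the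
largest size of an atom. -/
def AtomicMeasure.HasType (μ : AtomicMeasure) (m : List ℕ) : Prop :=
  m.length = μ.maxSize ∧ ∀ (k : ℕ) (hk : k < m.length), μ.count (k + 1) = m[k]

/-- The type of `μ` is strictly smaller than that of `ν`: either the largest size is smaller, or the
largest sizes agree and, going down from the largest size, the first size at which the numbers of
atoms differ has fewer atoms in `μ`. -/
def AtomicMeasure.SmallerType (μ ν : AtomicMeasure) : Prop :=
  μ.maxSize < ν.maxSize ∨
    (μ.maxSize = ν.maxSize ∧ ∃ k : ℕ, 1 ≤ k ∧ k ≤ μ.maxSize ∧ μ.count k < ν.count k ∧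
      ∀ j : ℕ, k < j → j ≤ μ.maxSize → μ.count j = ν.count j)

/-- `μ` is a minimal representing measure of `β`. -/
def AtomicMeasure.IsMinimal (μ : AtomicMeasure) (β : TracialSequence) : Prop :=
  μ.Represents β ∧ ∀ ν : AtomicMeasure, ν.Represents β → ¬ ν.SmallerType μ

/-- `β` admits a minimal measure of type `(m_1, …, m_r)` with `r > 1`. -/
def TracialSequence.AdmitsNCMeasure (β : TracialSequence) : Prop :=
  ∃ μ : AtomicMeasure, μ.IsMinimal β ∧ 1 < μ.maxSize

/-- The two measures agree up to the enumeration of the atoms and the replacement of each atom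
`(A, B)` by `(U A Uᵀ, U B Uᵀ)` with an orthogonal matrix `U`. -/
def AtomicMeasure.OrthogonallyEquivalent (μ ν : AtomicMeasure) : Prop :=
  ∃ σ : Fin μ.N ≃ Fin ν.N, ∀ i : Fin μ.N,
    μ.size i = ν.size (σ i) ∧ μ.density i = ν.density (σ i) ∧
      ∃ U : Matrix (Fin (ν.size (σ i))) (Fin (μ.size i)) ℝ,
        U * U.transpose = 1 ∧ U.transpose * U = 1 ∧
          ν.A (σ i) = U * μ.A i * U.transpose ∧ ν.B (σ i) = U * μ.B i * U.transpose

/-- A minimal representing measure of `β` exists and is unique up to orthogonal equivalence. -/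
def TracialSequence.HasUniqueMinimalMeasure (β : TracialSequence) : Prop :=
  ∃ μ : AtomicMeasure, μ.IsMinimal β ∧
    ∀ ν : AtomicMeasure, ν.IsMinimal β → μ.OrthogonallyEquivalent ν

/-- `β_{X³} = 0`, `β_{X²} > 0`, `0 < |β_Y| < 1` and `β_{X⁴} ≥ β_{X²}² / (1 - |β_Y|)`. -/
def TracialSequence.MomentConditions (β : TracialSequence) : Prop :=
  β.moment [.X, .X, .X] = 0 ∧ 0 < β.moment [.X, .X] ∧
    0 < |β.moment [.Y]| ∧ |β.moment [.Y]| < 1 ∧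
      β.moment [.X, .X] ^ 2 / (1 - |β.moment [.Y]|) ≤ β.moment [.X, .X, .X, .X]

end TracialMoment

namespace TracialMoment

open Matrix

/-! ### Moments of a sequence with `XY + YX = 0` and `Y² = 1` -/

/-! Write b = β_Y, c = β_{X²}, e = β_{X⁴}. The column relations pass to the atoms: the integrals of
(AB + BA)ᵗ(AB + BA) and (B² - 1)ᵗ(B² - 1) are combinations of moments of degree at most 4 and
vanish, so every atom satisfies AB = -BA and B² = 1 (`Represents.anticommute`,
`Represents.B_mul_B`). Thus an atom of size 1 is (0, ±1), and an atom of size 2 with A ≠ 0 is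
orthogonally equivalent to (`flip x`, `signs`) with x > 0.

Necessity. A³ anticommutes with the involution B, hence has trace 0, and β_{X³} = 0. The matrices 1
± B are positive semidefinite and commute with A², and tr(A²B) = tr(A⁴B) = 0; a Cauchy-Schwarz
argument with weight 1 ± B gives c² ≤ e(1 - |b|) (`Represents.sq_moment_le`).

Sufficiency. One atom of size 2 with density l must satisfy l x² = c and l x⁴ = e, so l = c²/e and x
= √(e/c). The remaining mass 1 - l sits at (0, ±1) with densities (1 - l ± b)/2. Both are positive
if c²/e < 1 - |b|; in the boundary case, with b ≠ 0, one of them vanishes and the other is |b|. If b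
= 0, equality would give 𝕏² = c𝟏 and rank at most 4, which rank 5 excludes.

Minimality and uniqueness. Noncommutativity gives c ≠ 0, which forces an atom of size at least 2. A
measure whose largest size is 2, with a single atom of that size, has the same l and x, hence the
same total mass at each of (0, 1) and (0, -1). It therefore needs at least one atom of size 1 for
each sign used, and with exactly one for each sign everything is determined. `CanonicalData`
packages the parameters for both counts of such atoms. -/

/-- The sequence is normalized and its moment matrix satisfies the column relations
`XY + YX = 0` and `Y² = 1`. -/
structure TracialSequence.IsAnticommuting (β : TracialSequence) : Prop where
  norm : β.IsNormalized
  xy : β.column [.X, .Y] + β.column [.Y, .X] = 0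
  yy : β.column [.Y, .Y] = β.column []

theorem TracialSequence.moment_rotate (β : TracialSequence) (w : List Letter) (n : ℕ)
    (hw : w.length ≤ 4) :
    β.moment (w.rotate n) (by simpa using hw) = β.moment w hw :=
  (β.cyclic ⟨w, hw⟩ ⟨w.rotate n, by simpa using hw⟩ ⟨n, rfl⟩).symm

/-- The value of the moment of a word that the relations `XY + YX = 0` and `Y² = 1` force, in terms
of `b = β_Y`, `c = β_{X²}`, `d = β_{X³}` and `e = β_{X⁴}`. -/
def reducedMoment (b c d e : ℝ) : List Letter → ℝ
  | [] => 1
  | [.Y] => b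
  | [.X, .X] => c
  | [.Y, .Y] => 1
  | [.X, .X, .X] => d
  | [.Y, .Y, .Y] => b
  | [.X, .X, .X, .X] => e
  | [.X, .X, .Y, .Y] => c
  | [.X, .Y, .Y, .X] => c
  | [.Y, .Y, .X, .X] => c
  | [.Y, .X, .X, .Y] => c
  | [.X, .Y, .X, .Y] => -c
  | [.Y, .X, .Y, .X] => -c
  | [.Y, .Y, .Y, .Y] => 1
  | _ => 0

/-- The entries of the two column relations, combined with cyclic invariance, form a linear system
that determines all other moments. For example, β_{XYY} equals β_X by one relation and its own
negative by the other. -/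
theorem TracialSequence.IsAnticommuting.moment_eq {β : TracialSequence} (h : β.IsAnticommuting)
    (w : List Letter) (hw : w.length ≤ 4) :
    β.moment w hw = reducedMoment (β.moment [.Y]) (β.moment [.X, .X]) (β.moment [.X, .X, .X])
      (β.moment [.X, .X, .X, .X]) w := by
  have r := β.moment_rotate
  have hn := h.norm
  have p := congrFun h.xy
  have q := congrFun h.yy
  have p0 := p 0
  have p1 := p 1
  have p2 := p 2
  have p3 := p 3
  have p4 := p 4
  have p6 := p 6
  have q0 := q 0
  have q1 := q 1
  have q2 := q 2
  have q3 := q 3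
  have q4 := q 4
  have q6 := q 6
  simp only [TracialSequence.IsNormalized] at hn
  simp only [TracialSequence.column, wordsTwo, Pi.add_apply, Pi.zero_apply, Matrix.cons_val,
    List.reverse_nil, List.reverse_cons, List.nil_append, List.cons_append]
    at p0 p1 p2 p3 p4 p6 q0 q1 q2 q3 q4 q6
  have r1 := r [.X, .Y] 1 (by simp)
  have r2 := r [.X, .X, .Y] 1 (by simp)
  have r3 := r [.X, .X, .Y] 2 (by simp)
  have r4 := r [.X, .Y, .Y] 1 (by simp)
  have r5 := r [.X, .Y, .Y] 2 (by simp)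
  have r6 := r [.X, .X, .X, .Y] 1 (by simp)
  have r7 := r [.X, .X, .X, .Y] 2 (by simp)
  have r8 := r [.X, .X, .X, .Y] 3 (by simp)
  have r9 := r [.X, .X, .Y, .Y] 1 (by simp)
  have r10 := r [.X, .X, .Y, .Y] 2 (by simp)
  have r11 := r [.X, .X, .Y, .Y] 3 (by simp)
  have r12 := r [.X, .Y, .X, .Y] 1 (by simp)
  have r13 := r [.X, .Y, .Y, .Y] 1 (by simp)
  have r14 := r [.X, .Y, .Y, .Y] 2 (by simp)
  have r15 := r [.X, .Y, .Y, .Y] 3 (by simp)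
  simp only [List.rotate_cons_succ, List.cons_append, List.nil_append, List.rotate_zero]
    at r1 r2 r3 r4 r5 r6 r7 r8 r9 r10 r11 r12 r13 r14 r15
  rcases w with _ | ⟨_ | _, _ | ⟨_ | _, _ | ⟨_ | _, _ | ⟨_ | _, _ | ⟨_, w⟩⟩⟩⟩⟩ <;>
  first
  | rfl
  | (simp only [reducedMoment]; linarith)
  | (simp at hw; omega)

/-! ### Evaluation of words -/

theorem evalWord_nil {t : ℕ} (A B : Matrix (Fin t) (Fin t) ℝ) : evalWord A B [] = 1 := rfl

theorem evalWord_cons_X {t : ℕ} (A B : Matrix (Fin t) (Fin t) ℝ) (w : List Letter) :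
    evalWord A B (.X :: w) = A * evalWord A B w := by simp [evalWord]

theorem evalWord_cons_Y {t : ℕ} (A B : Matrix (Fin t) (Fin t) ℝ) (w : List Letter) :
    evalWord A B (.Y :: w) = B * evalWord A B w := by simp [evalWord]

theorem evalWord_append {t : ℕ} (A B : Matrix (Fin t) (Fin t) ℝ) (v w : List Letter) :
    evalWord A B (v ++ w) = evalWord A B v * evalWord A B w := by simp [evalWord]

theorem evalWord_reverse {t : ℕ} {A B : Matrix (Fin t) (Fin t) ℝ} (hA : A.IsSymm) (hB : B.IsSymm)
    (w : List Letter) : evalWord A B w.reverse = (evalWord A B w)ᵀ := by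
  induction w with
  | nil => simp [evalWord]
  | cons l w ih =>
    rw [List.reverse_cons, evalWord_append, ih]
    cases l <;> simp [evalWord, Matrix.transpose_mul, hA.eq, hB.eq]

/-! ### Consequences of the existence of a representing measure -/

/-- The functional `∑ i, λ_i Tr (F_i)` on families of matrices indexed by the atoms. -/
noncomputable def AtomicMeasure.integral (μ : AtomicMeasure)
    (F : (i : Fin μ.N) → Matrix (Fin (μ.size i)) (Fin (μ.size i)) ℝ) : ℝ :=
  ∑ i, μ.density i * ((1 / (μ.size i : ℝ)) * (F i).trace)

namespace AtomicMeasure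

variable {μ : AtomicMeasure}

theorem integral_add (F G : (i : Fin μ.N) → Matrix (Fin (μ.size i)) (Fin (μ.size i)) ℝ) :
    μ.integral (F + G) = μ.integral F + μ.integral G := by
  simp [integral, Matrix.trace_add, mul_add, Finset.sum_add_distrib]

theorem integral_smul (r : ℝ) (F : (i : Fin μ.N) → Matrix (Fin (μ.size i)) (Fin (μ.size i)) ℝ) :
    μ.integral (r • F) = r * μ.integral F := by
  simp only [integral, Pi.smul_apply, Matrix.trace_smul, Finset.mul_sum, smul_eq_mul]
  exact Finset.sum_congr rfl fun i _ => by ring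

theorem weight_pos (i : Fin μ.N) : 0 < μ.density i * (1 / (μ.size i : ℝ)) := by
  have := μ.size_pos i
  have := μ.density_pos i
  positivity

theorem trace_transpose_mul_self_nonneg {m n : Type*} [Fintype m] [Fintype n]
    (F : Matrix m n ℝ) : 0 ≤ (Fᵀ * F).trace := by
  rw [← Matrix.conjTranspose_eq_transpose_of_trivial]
  exact (Matrix.posSemidef_conjTranspose_mul_self F).trace_nonneg

/-- The densities are positive and each trace is a squared Frobenius norm, so a vanishing sum
vanishes term by term. -/
theorem eq_zero_of_integral_transpose_mul_self
    {F : (i : Fin μ.N) → Matrix (Fin (μ.size i)) (Fin (μ.size i)) ℝ}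
    (h : (μ.integral fun i => (F i)ᵀ * F i) = 0) (i : Fin μ.N) : F i = 0 := by
  rw [integral, Finset.sum_eq_zero_iff_of_nonneg] at h
  · have h1 := h i (Finset.mem_univ i)
    rw [← mul_assoc, mul_eq_zero, or_iff_right (weight_pos i).ne'] at h1
    rwa [← Matrix.conjTranspose_eq_transpose_of_trivial,
      Matrix.trace_conjTranspose_mul_self_eq_zero_iff] at h1
  · intro i _
    rw [← mul_assoc]
    exact mul_nonneg (weight_pos i).le (trace_transpose_mul_self_nonneg _)

theorem Represents.integral_evalWord {β : TracialSequence} (h : μ.Represents β) (w : List Letter)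
    (hw : w.length ≤ 4) :
    (μ.integral fun i => evalWord (μ.A i) (μ.B i) w) = β.moment w hw := (h w hw).symm

/-- The moment matrix is a positive combination, over the atoms, of Gram matrices of the evaluated
words for the trace inner product. -/
theorem Represents.posSemidef {β : TracialSequence} (h : μ.Represents β) :
    β.momentMatrix.PosSemidef := by
  have key : β.momentMatrix = ∑ i, (μ.density i * (1 / (μ.size i : ℝ))) •
      Matrix.of fun j k => ((evalWord (μ.A i) (μ.B i) (wordsTwo j))ᵀ *
        evalWord (μ.A i) (μ.B i) (wordsTwo k)).trace := by
    ext j k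
    simp only [TracialSequence.momentMatrix, TracialSequence.column, Matrix.of_apply,
      Matrix.sum_apply, Matrix.smul_apply, smul_eq_mul]
    rw [h]
    refine Finset.sum_congr rfl fun i _ => ?_
    rw [evalWord_append, evalWord_reverse (μ.A_symm i) (μ.B_symm i), mul_assoc]
  rw [key]
  refine Matrix.posSemidef_sum _ fun i _ => Matrix.PosSemidef.smul ?_ (weight_pos i).le
  refine Matrix.PosSemidef.of_dotProduct_mulVec_nonneg ?_ fun x => ?_
  · ext j k
    rw [Matrix.conjTranspose_eq_transpose_of_trivial, Matrix.transpose_apply, Matrix.of_apply,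
      Matrix.of_apply, ← Matrix.trace_transpose, Matrix.transpose_mul, Matrix.transpose_transpose]
  · refine (trace_transpose_mul_self_nonneg
      (∑ j, x j • evalWord (μ.A i) (μ.B i) (wordsTwo j))).trans_eq ?_
    simp only [dotProduct, Matrix.mulVec, Matrix.of_apply, Matrix.transpose_sum,
      Matrix.transpose_smul, Matrix.sum_mul, Matrix.trace_sum, Matrix.smul_mul, Matrix.mul_smul,
      Matrix.trace_smul, smul_eq_mul, Finset.mul_sum, Pi.star_apply, star_trivial]
    rw [Finset.sum_comm]
    exact Finset.sum_congr rfl fun j _ => Finset.sum_congr rfl fun k _ => by ring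

theorem Represents.anticommute {β : TracialSequence} (h : μ.Represents β)
    (hβ : β.IsAnticommuting) (i : Fin μ.N) : μ.A i * μ.B i = -(μ.B i * μ.A i) := by
  rw [eq_neg_iff_add_eq_zero]
  refine eq_zero_of_integral_transpose_mul_self
    (F := fun i => μ.A i * μ.B i + μ.B i * μ.A i) ?_ i
  have e : (fun i => (μ.A i * μ.B i + μ.B i * μ.A i)ᵀ * (μ.A i * μ.B i + μ.B i * μ.A i)) =
      (fun i => evalWord (μ.A i) (μ.B i) [.Y, .X, .X, .Y]) +
      (fun i => evalWord (μ.A i) (μ.B i) [.Y, .X, .Y, .X]) +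
      ((fun i => evalWord (μ.A i) (μ.B i) [.X, .Y, .X, .Y]) +
      (fun i => evalWord (μ.A i) (μ.B i) [.X, .Y, .Y, .X])) := by
    funext i
    simp only [Pi.add_apply, evalWord_cons_X, evalWord_cons_Y, evalWord_nil, mul_one,
      Matrix.transpose_add, Matrix.transpose_mul, (μ.A_symm i).eq, (μ.B_symm i).eq]
    noncomm_ring
  rw [e, integral_add, integral_add, integral_add, h.integral_evalWord _ (by simp),
    h.integral_evalWord _ (by simp), h.integral_evalWord _ (by simp),
    h.integral_evalWord _ (by simp)]
  simp only [hβ.moment_eq [.Y, .X, .X, .Y], hβ.moment_eq [.Y, .X, .Y, .X],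
    hβ.moment_eq [.X, .Y, .X, .Y], hβ.moment_eq [.X, .Y, .Y, .X], reducedMoment]
  ring

theorem Represents.B_mul_B {β : TracialSequence} (h : μ.Represents β)
    (hβ : β.IsAnticommuting) (i : Fin μ.N) : μ.B i * μ.B i = 1 := by
  rw [← sub_eq_zero]
  refine eq_zero_of_integral_transpose_mul_self (F := fun i => μ.B i * μ.B i - 1) ?_ i
  have e : (fun i => (μ.B i * μ.B i - 1)ᵀ * (μ.B i * μ.B i - 1)) =
      (fun i => evalWord (μ.A i) (μ.B i) [.Y, .Y, .Y, .Y]) +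
      ((-2 : ℝ) • (fun i => evalWord (μ.A i) (μ.B i) [.Y, .Y]) +
      (fun i => evalWord (μ.A i) (μ.B i) [])) := by
    funext i
    simp only [Pi.add_apply, evalWord_cons_Y, evalWord_nil, mul_one,
      Matrix.transpose_sub, Matrix.transpose_mul, (μ.B_symm i).eq, Matrix.transpose_one]
    change _ = _ + ((-2 : ℝ) • (μ.B i * μ.B i) + 1)
    rw [neg_smul, two_smul]
    noncomm_ring
  rw [e, integral_add, integral_add, integral_smul, h.integral_evalWord _ (by simp),
    h.integral_evalWord _ (by simp), h.integral_evalWord _ (by simp)]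
  simp only [hβ.moment_eq [.Y, .Y, .Y, .Y], hβ.moment_eq [.Y, .Y], hβ.moment_eq [], reducedMoment]
  ring

end AtomicMeasure

/-! ### Traces for anticommuting pairs and the moment inequality -/

theorem trace_mul_mul_eq_zero_of_anticommute {n : Type*} [Fintype n] {A B Q : Matrix n n ℝ}
    (h : A * B = -(B * A)) (hQ : A * Q = Q * A) : (A * Q * B).trace = 0 := by
  have h1 : A * Q * B = -(Q * B * A) := by rw [hQ, mul_assoc, h, mul_neg, mul_assoc]
  have h2 := congrArg Matrix.trace h1
  rw [Matrix.trace_neg, Matrix.trace_mul_comm (Q * B) A, ← mul_assoc] at h2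
  linarith

/-- Conjugation by B preserves the trace and sends P to -P. -/
theorem trace_eq_zero_of_anticommute {n : Type*} [Fintype n] [DecidableEq n] {P B : Matrix n n ℝ}
    (h : P * B = -(B * P)) (hB : B * B = 1) : P.trace = 0 := by
  have h1 : P = -(B * (P * B)) := by rw [h, mul_neg, neg_neg, ← mul_assoc, hB, one_mul]
  have h2 := congrArg Matrix.trace h1
  rw [Matrix.trace_neg, Matrix.trace_mul_comm, mul_assoc, hB, mul_one] at h2
  linarith

/-- For `A` anticommuting with the symmetric involution `B`, the positivity of the trace of
`(s A² + t) (1 + ε B) (s A² + t)`, where `ε = ±1`. -/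
theorem trace_quadratic_nonneg {n : Type*} [Fintype n] [DecidableEq n] {A B : Matrix n n ℝ}
    (hA : A.IsSymm) (hB : B.IsSymm) (h : A * B = -(B * A)) (hBB : B * B = 1) {ε : ℝ}
    (hε : ε * ε = 1) (s t : ℝ) :
    0 ≤ s ^ 2 * (A * (A * (A * A))).trace + 2 * s * t * (A * A).trace +
      t ^ 2 * ((1 : Matrix n n ℝ).trace + ε * B.trace) := by
  have hc : A * A * B = B * (A * A) := by
    rw [mul_assoc, h, mul_neg, ← mul_assoc, h, neg_mul, neg_neg, mul_assoc]
  have h2 : (A * A * B).trace = 0 := trace_mul_mul_eq_zero_of_anticommute h rfl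
  have h4 : (A * (A * (A * A)) * B).trace = 0 :=
    trace_mul_mul_eq_zero_of_anticommute h (by simp only [mul_assoc])
  have h0 := AtomicMeasure.trace_transpose_mul_self_nonneg ((1 + ε • B) * (s • (A * A) + t • 1))
  have hG : (s • (A * A) + t • 1) * B = B * (s • (A * A) + t • 1) := by
    simp only [add_mul, mul_add, smul_mul_assoc, mul_smul_comm, hc, one_mul, mul_one]
  -- (1 + εB)/2 is a projection, so the square of 1 + εB reproduces it up to the factor 2.
  have hP : (1 + ε • B) * (1 + ε • B) = (2 : ℝ) • (1 + ε • B) := by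
    have : (1 + ε • B) * (1 + ε • B) = 1 + (2 * ε) • B + (ε * ε) • (1 : Matrix n n ℝ) := by
      simp only [add_mul, mul_add, smul_mul_assoc, mul_smul_comm, hBB, one_mul, mul_one]
      module
    rw [this, hε]
    module
  have hPt : (1 + ε • B)ᵀ = 1 + ε • B := by simp [hB.eq]
  have hGt : (s • (A * A) + t • 1)ᵀ = s • (A * A) + t • (1 : Matrix n n ℝ) := by
    simp [hA.eq, Matrix.transpose_mul]
  have e : ((1 + ε • B) * (s • (A * A) + t • 1))ᵀ * ((1 + ε • B) * (s • (A * A) + t • 1)) =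
      (2 : ℝ) • (s ^ 2 • (A * (A * (A * A))) + (2 * s * t) • (A * A) + t ^ 2 • 1 +
        ε • (s ^ 2 • (A * (A * (A * A)) * B) + (2 * s * t) • (A * A * B) + t ^ 2 • B)) := by
    have hGG : (s • (A * A) + t • 1) * (s • (A * A) + t • (1 : Matrix n n ℝ)) =
        s ^ 2 • (A * (A * (A * A))) + (2 * s * t) • (A * A) + t ^ 2 • 1 := by
      simp only [add_mul, mul_add, smul_mul_assoc, mul_smul_comm, one_mul, mul_one, mul_assoc]
      module
    rw [Matrix.transpose_mul, hPt, hGt, mul_assoc, ← mul_assoc (1 + ε • B), hP, smul_mul_assoc,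
      mul_smul_comm, add_mul 1, one_mul, smul_mul_assoc, ← hG, mul_add _ _ (ε • _), mul_smul_comm,
      ← mul_assoc, hGG]
    simp only [add_mul, smul_mul_assoc, one_mul]
  rw [e] at h0
  simp only [Matrix.trace_smul, Matrix.trace_add, smul_eq_mul, h2, h4] at h0
  linarith

namespace AtomicMeasure

variable {μ : AtomicMeasure} {β : TracialSequence}

theorem Represents.moment_XXX_eq_zero (h : μ.Represents β) (hβ : β.IsAnticommuting) :
    β.moment [.X, .X, .X] = 0 := by
  rw [h]
  refine Finset.sum_eq_zero fun i _ => ?_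
  have hc := h.anticommute hβ i
  have h3 : μ.A i * (μ.A i * μ.A i) * μ.B i = -(μ.B i * (μ.A i * (μ.A i * μ.A i))) := by
    rw [mul_assoc, mul_assoc, hc, mul_neg, ← mul_assoc (μ.A i) (μ.B i), hc, neg_mul, neg_neg,
      mul_assoc, ← mul_assoc, hc, neg_mul, mul_assoc]
  rw [evalWord_cons_X, evalWord_cons_X, evalWord_cons_X, evalWord_nil, mul_one,
    trace_eq_zero_of_anticommute h3 (h.B_mul_B hβ i)]
  ring

theorem Represents.quadratic_nonneg (h : μ.Represents β) (hβ : β.IsAnticommuting) {ε : ℝ}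
    (hε : ε * ε = 1) (s t : ℝ) :
    0 ≤ s ^ 2 * β.moment [.X, .X, .X, .X] + 2 * s * t * β.moment [.X, .X] +
      t ^ 2 * (1 + ε * β.moment [.Y]) := by
  have h0 : (1 : ℝ) = β.moment [] := hβ.norm.symm
  rw [h0, h, h, h, h]
  simp only [Finset.mul_sum, ← Finset.sum_add_distrib]
  refine Finset.sum_nonneg fun i _ => ?_
  have h1 := mul_nonneg (weight_pos i).le (trace_quadratic_nonneg (μ.A_symm i) (μ.B_symm i)
    (h.anticommute hβ i) (h.B_mul_B hβ i) hε s t)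
  simp only [evalWord_cons_X, evalWord_cons_Y, evalWord_nil, mul_one]
  refine h1.trans_eq ?_
  ring

/-- The inequality `β_{X²}² ≤ β_{X⁴} (1 - |β_Y|)`. -/
theorem Represents.sq_moment_le (h : μ.Represents β) (hβ : β.IsAnticommuting) :
    β.moment [.X, .X] ^ 2 ≤ β.moment [.X, .X, .X, .X] * (1 - |β.moment [.Y]|) := by
  have key : ∀ ε : ℝ, ε * ε = 1 →
      β.moment [.X, .X] ^ 2 ≤ β.moment [.X, .X, .X, .X] * (1 + ε * β.moment [.Y]) := by
    intro ε hε
    -- With t = 1 the form is a polynomial in s that is nowhere negative.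
    have h1 := discrim_le_zero (a := β.moment [.X, .X, .X, .X]) (b := 2 * β.moment [.X, .X])
      (c := 1 + ε * β.moment [.Y]) fun s => by
        have := h.quadratic_nonneg hβ hε s 1
        linarith
    rw [discrim] at h1
    linarith
  rcases abs_cases (β.moment [.Y]) with ⟨hb, -⟩ | ⟨hb, -⟩ <;> rw [hb]
  · simpa [sub_eq_add_neg] using key (-1) (by norm_num)
  · simpa using key 1 (by norm_num)

end AtomicMeasure

/-! ### Normal forms of small atoms -/

/-- The first matrix of the normal form of an irreducible atom of size `2`. -/
def flip (x : ℝ) : Matrix (Fin 2) (Fin 2) ℝ := !![0, x; x, 0]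

/-- The second matrix of the normal form of an irreducible atom of size `2`. -/
def signs : Matrix (Fin 2) (Fin 2) ℝ := !![1, 0; 0, -1]

theorem flip_isSymm (x : ℝ) : (flip x).IsSymm := by
  ext i j
  fin_cases i <;> fin_cases j <;> simp [flip]

theorem signs_isSymm : signs.IsSymm := by
  ext i j
  fin_cases i <;> fin_cases j <;> simp [signs]

/-- The `1 × 1` matrix with entry `r`. -/
def point (r : ℝ) : Matrix (Fin 1) (Fin 1) ℝ := Matrix.of fun _ _ => r

/-- s + it is a complex square root of p + iq, and has modulus 1 because its square does. -/
theorem exists_half_angle {p q : ℝ} (h : p ^ 2 + q ^ 2 = 1) :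
    ∃ s t : ℝ, s ^ 2 + t ^ 2 = 1 ∧ s ^ 2 - t ^ 2 = p ∧ 2 * s * t = q := by
  obtain ⟨z, hz⟩ := IsAlgClosed.exists_pow_nat_eq (⟨p, q⟩ : ℂ) two_pos
  have hre : z.re * z.re - z.im * z.im = p := by
    simpa [sq, Complex.mul_re] using congrArg Complex.re hz
  have him : z.re * z.im + z.im * z.re = q := by
    simpa [sq, Complex.mul_im] using congrArg Complex.im hz
  refine ⟨z.re, z.im, ?_, by linarith, by linarith⟩
  have h4 : (z.re ^ 2 + z.im ^ 2) ^ 2 = 1 := by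
    rw [← h, ← hre, ← him]
    ring
  exact (pow_eq_one_iff_of_nonneg (by positivity) two_ne_zero).1 h4

/-- A symmetric involution of trace 0 in the plane is a reflection, diagonalized by the rotation
through half its angle. The sign ε on the second column leaves `signs` fixed and turns `flip k` into
`flip (ε * k)`, so that the parameter can be made positive. -/
theorem orthogonal_half_angle {s t ε : ℝ} (h : s ^ 2 + t ^ 2 = 1) (hε : ε * ε = 1) (k : ℝ) :
    !![s, -ε * t; t, ε * s] * !![s, -ε * t; t, ε * s]ᵀ = 1 ∧
    !![s, -ε * t; t, ε * s]ᵀ * !![s, -ε * t; t, ε * s] = 1 ∧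
    !![-k * (2 * s * t), k * (s ^ 2 - t ^ 2); k * (s ^ 2 - t ^ 2), -(-k * (2 * s * t))] =
      !![s, -ε * t; t, ε * s] * flip (ε * k) * !![s, -ε * t; t, ε * s]ᵀ ∧
    !![s ^ 2 - t ^ 2, 2 * s * t; 2 * s * t, -(s ^ 2 - t ^ 2)] =
      !![s, -ε * t; t, ε * s] * signs * !![s, -ε * t; t, ε * s]ᵀ := by
  have hU : !![s, -ε * t; t, ε * s]ᵀ = !![s, t; -ε * t, ε * s] := by
    ext i j
    fin_cases i <;> fin_cases j <;> simp
  rw [hU, flip, signs]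
  simp only [Matrix.mul_fin_two, Matrix.one_fin_two]
  refine ⟨?_, ?_, ?_, ?_⟩ <;> ext i j <;> fin_cases i <;> fin_cases j <;>
    simp only [Fin.zero_eta, Fin.mk_one, Matrix.of_apply, Matrix.cons_val]
  · linear_combination h + t ^ 2 * hε
  · linear_combination -(s * t) * hε
  · linear_combination -(s * t) * hε
  · linear_combination h + s ^ 2 * hε
  · linear_combination h
  · ring
  · ring
  · linear_combination h + (s ^ 2 + t ^ 2) * hε
  · linear_combination (2 * k * s * t) * hε
  · linear_combination -(k * (s ^ 2 - t ^ 2)) * hε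
  · linear_combination -(k * (s ^ 2 - t ^ 2)) * hε
  · linear_combination -(2 * k * s * t) * hε
  · linear_combination t ^ 2 * hε
  · linear_combination -(s * t) * hε
  · linear_combination -(s * t) * hε
  · linear_combination s ^ 2 * hε

theorem exists_normal_form_of_size_one {t : ℕ} (ht : t = 1) {A B : Matrix (Fin t) (Fin t) ℝ}
    (h : A * B = -(B * A)) (hB : B * B = 1) :
    A = 0 ∧ (B.trace = 1 ∨ B.trace = -1) ∧ ∃ U : Matrix (Fin t) (Fin 1) ℝ,
      U * Uᵀ = 1 ∧ Uᵀ * U = 1 ∧ B = U * point B.trace * Uᵀ := by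
  subst ht
  have hb : B 0 0 * B 0 0 = 1 := by
    simpa [Matrix.mul_apply] using congrFun (congrFun hB 0) 0
  have ha : A 0 0 = 0 := by
    have h1 := congrFun (congrFun h 0) 0
    simp only [Matrix.mul_apply, Finset.univ_unique, Fin.default_eq_zero, Fin.isValue,
      Finset.sum_singleton, Matrix.neg_apply] at h1
    linear_combination (B 0 0 / 2) * h1 - A 0 0 * hb
  have htr : B.trace = B 0 0 := by simp [Matrix.trace]
  refine ⟨by ext i j; fin_cases i; fin_cases j; simpa using ha, ?_, 1, by simp, by simp, ?_⟩
  · rw [htr]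
    exact mul_self_eq_one_iff.1 hb
  · ext i j
    fin_cases i
    fin_cases j
    simp [htr, point]

theorem exists_normal_form_of_size_two {t : ℕ} (ht : t = 2) {A B : Matrix (Fin t) (Fin t) ℝ}
    (hAs : A.IsSymm) (hBs : B.IsSymm) (h : A * B = -(B * A)) (hB : B * B = 1) (hA : A ≠ 0) :
    ∃ x : ℝ, 0 < x ∧ ∃ U : Matrix (Fin t) (Fin 2) ℝ,
      U * Uᵀ = 1 ∧ Uᵀ * U = 1 ∧ A = U * flip x * Uᵀ ∧ B = U * signs * Uᵀ := by
  subst ht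
  have trA := trace_eq_zero_of_anticommute h hB
  obtain ⟨u, v, u', rfl⟩ : ∃ u v u' : ℝ, A = !![u, v; v, u'] :=
    ⟨A 0 0, A 0 1, A 1 1, by rw [Matrix.eta_fin_two A]; simp [hAs.apply 0 1]⟩
  obtain ⟨p, q, p', rfl⟩ : ∃ p q p' : ℝ, B = !![p, q; q, p'] :=
    ⟨B 0 0, B 0 1, B 1 1, by rw [Matrix.eta_fin_two B]; simp [hBs.apply 0 1]⟩
  rw [Matrix.trace_fin_two_of] at trA
  obtain rfl : u' = -u := by linarith
  have hne : u ^ 2 + v ^ 2 ≠ 0 := by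
    intro h0
    have hu : u = 0 := by nlinarith [sq_nonneg u, sq_nonneg v]
    have hv : v = 0 := by nlinarith [sq_nonneg u, sq_nonneg v]
    exact hA (by subst hu hv; ext i j; fin_cases i <;> fin_cases j <;> simp)
  have entry : ∀ i j, (!![u, v; v, -u] * !![p, q; q, p'] : Matrix (Fin 2) (Fin 2) ℝ) i j =
    (-(!![p, q; q, p'] * !![u, v; v, -u]) : Matrix (Fin 2) (Fin 2) ℝ) i j := fun i j => by rw [h]
  have e00 := entry 0 0
  have e01 := entry 0 1
  have e11 := entry 1 1
  have b00 := congrFun (congrFun hB 0) 0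
  simp only [Matrix.mul_fin_two, Matrix.neg_apply, Matrix.of_apply, Matrix.cons_val] at e00 e01 e11
  simp at b00
  -- A is nonzero and anticommutes with B, so B has trace 0 as well.
  obtain rfl : p' = -p := by
    have : (u ^ 2 + v ^ 2) * (p + p') = 0 := by
      linear_combination (u / 2) * e00 - (u / 2) * e11 + v * e01
    rcases mul_eq_zero.1 this with h0 | h0
    · exact absurd h0 hne
    · linarith
  obtain ⟨s, t, hst, rfl, rfl⟩ := exists_half_angle (p := p) (q := q) (by linarith)
  -- Anticommutation says that (u, v) is orthogonal to the unit vector (p, q) = (s² - t², 2st).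
  -- Hence (u, v) = k(-q, p), and k is the inner product of (u, v) with (-q, p).
  set k := v * (s ^ 2 - t ^ 2) - u * (2 * s * t) with hk
  have hup : u * (s ^ 2 - t ^ 2) + v * (2 * s * t) = 0 := by linarith
  have hpq : (s ^ 2 - t ^ 2) ^ 2 + (2 * s * t) ^ 2 = 1 := by
    linear_combination (s ^ 2 + t ^ 2 + 1) * hst
  have hu : u = -k * (2 * s * t) := by
    linear_combination (s ^ 2 - t ^ 2) * hup - u * hpq
  have hv : v = k * (s ^ 2 - t ^ 2) := by
    linear_combination (2 * s * t) * hup - v * hpq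
  have hk0 : k ≠ 0 := by
    intro h0
    rw [h0] at hu hv
    simp only [neg_zero, zero_mul] at hu hv
    exact hne (by rw [hu, hv]; ring)
  obtain ⟨ε, hε, hεk⟩ : ∃ ε : ℝ, ε * ε = 1 ∧ 0 < ε * k := by
    rcases lt_or_gt_of_ne hk0 with h0 | h0
    · exact ⟨-1, by norm_num, by linarith⟩
    · exact ⟨1, by norm_num, by linarith⟩
  clear_value k
  subst hu hv
  exact ⟨ε * k, hεk, _, orthogonal_half_angle hst hε k⟩

/-! ### The canonical measure -/

/-- One atom of size `2` in normal form, and `n` atoms `(0, ε j)` of size `1`. -/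
noncomputable def canonicalMeasure (n : ℕ) (x l : ℝ) (α ε : Fin n → ℝ) (hl : 0 < l)
    (hα : ∀ j, 0 < α j) (hsum : l + ∑ j, α j = 1) : AtomicMeasure where
  N := n + 1
  size := Fin.cases 2 fun _ => 1
  size_pos := Fin.cases (by simp) fun _ => by simp
  density := Fin.cases l α
  density_pos := Fin.cases hl hα
  density_sum := by simpa [Fin.sum_univ_succ] using hsum
  A := Fin.cases (flip x) fun _ => (0 : Matrix (Fin 1) (Fin 1) ℝ)
  B := Fin.cases signs fun j => point (ε j)
  A_symm := Fin.cases (flip_isSymm x)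
    fun _ => Matrix.isSymm_zero
  B_symm := Fin.cases signs_isSymm fun _ => rfl

/-- The normal form obeys the two relations itself, with β_Y = β_{X³} = 0. The factor 2 is cancelled
by normalizing the trace. -/
theorem trace_evalWord_flip_signs (x : ℝ) (w : List Letter) (hw : w.length ≤ 4) :
    (evalWord (flip x) signs w).trace = 2 * reducedMoment 0 (x ^ 2) 0 (x ^ 4) w := by
  rcases w with _ | ⟨_ | _, _ | ⟨_ | _, _ | ⟨_ | _, _ | ⟨_ | _, _ | ⟨_, w⟩⟩⟩⟩⟩ <;>
  first
  | (simp at hw; omega)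
  | (simp [evalWord, reducedMoment, flip, signs, Matrix.trace_fin_two]; done)
  | (simp [evalWord, reducedMoment, flip, signs, Matrix.trace_fin_two]; ring)

theorem trace_evalWord_one {ε : ℝ} (hε : ε * ε = 1) (w : List Letter) (hw : w.length ≤ 4) :
    (evalWord (0 : Matrix (Fin 1) (Fin 1) ℝ) (point ε) w).trace =
      reducedMoment ε 0 0 0 w := by
  rcases w with _ | ⟨_ | _, _ | ⟨_ | _, _ | ⟨_ | _, _ | ⟨_ | _, _ | ⟨_, w⟩⟩⟩⟩⟩ <;>
  first
  | (simp at hw; omega)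
  | simp [evalWord, reducedMoment, Matrix.trace, Matrix.mul_apply, point, hε]

theorem canonicalMeasure_represents {β : TracialSequence} (hβ : β.IsAnticommuting) {n : ℕ}
    {x l : ℝ} {α ε : Fin n → ℝ} (hl : 0 < l) (hα : ∀ j, 0 < α j) (hsum : l + ∑ j, α j = 1)
    (hε : ∀ j, ε j * ε j = 1) (hY : ∑ j, α j * ε j = β.moment [.Y])
    (hXX : l * x ^ 2 = β.moment [.X, .X]) (hXXX : β.moment [.X, .X, .X] = 0)
    (hXXXX : l * x ^ 4 = β.moment [.X, .X, .X, .X]) :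
    (canonicalMeasure n x l α ε hl hα hsum).Represents β := by
  intro w hw
  have e : ∑ i, (canonicalMeasure n x l α ε hl hα hsum).density i *
      ((1 / ((canonicalMeasure n x l α ε hl hα hsum).size i : ℝ)) *
        (evalWord ((canonicalMeasure n x l α ε hl hα hsum).A i)
          ((canonicalMeasure n x l α ε hl hα hsum).B i) w).trace) =
      l * (1 / ((2 : ℕ) : ℝ) * (evalWord (flip x) signs w).trace) +
      ∑ j, α j * (1 / ((1 : ℕ) : ℝ) *
        (evalWord (0 : Matrix (Fin 1) (Fin 1) ℝ) (point (ε j)) w).trace) :=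
    Fin.sum_univ_succ _
  rw [e, trace_evalWord_flip_signs x w hw,
    Finset.sum_congr rfl fun j _ => by rw [trace_evalWord_one (hε j) w hw],
    hβ.moment_eq w hw, ← hY, ← hXX, ← hXXXX, hXXX]
  simp only [Nat.cast_ofNat, Nat.cast_one, div_one, one_mul]
  unfold reducedMoment
  split <;> simp <;> linarith

theorem evalWord_conj {m n : ℕ} {U : Matrix (Fin m) (Fin n) ℝ} (h : U * Uᵀ = 1) (h' : Uᵀ * U = 1)
    (A B : Matrix (Fin n) (Fin n) ℝ) (w : List Letter) :
    evalWord (U * A * Uᵀ) (U * B * Uᵀ) w = U * evalWord A B w * Uᵀ := by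
  induction w with
  | nil => simp [evalWord_nil, h]
  | cons l w ih =>
    have key : ∀ C : Matrix (Fin n) (Fin n) ℝ,
        U * C * Uᵀ * (U * evalWord A B w * Uᵀ) = U * (C * evalWord A B w) * Uᵀ := fun C => by
      calc U * C * Uᵀ * (U * evalWord A B w * Uᵀ)
          = U * C * (Uᵀ * U) * evalWord A B w * Uᵀ := by simp only [Matrix.mul_assoc]
        _ = U * (C * evalWord A B w) * Uᵀ := by rw [h', Matrix.mul_one, Matrix.mul_assoc U]
    cases l
    · rw [evalWord_cons_X, evalWord_cons_X, ih, key]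
    · rw [evalWord_cons_Y, evalWord_cons_Y, ih, key]

theorem trace_evalWord_conj {m n : ℕ} {U : Matrix (Fin m) (Fin n) ℝ} (h : U * Uᵀ = 1)
    (h' : Uᵀ * U = 1) (A B : Matrix (Fin n) (Fin n) ℝ) (w : List Letter) :
    (evalWord (U * A * Uᵀ) (U * B * Uᵀ) w).trace = (evalWord A B w).trace := by
  rw [evalWord_conj h h', Matrix.trace_mul_comm, ← Matrix.mul_assoc, h', Matrix.one_mul]

namespace AtomicMeasure

/-! ### Measures with one atom of size `2` and all others of size `1` -/

theorem maxSize_eq_two {μ : AtomicMeasure} {i₀ : Fin μ.N} (h2 : μ.size i₀ = 2)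
    (h1 : ∀ i, i ≠ i₀ → μ.size i = 1) : μ.maxSize = 2 := by
  refine le_antisymm (Finset.sup_le fun i _ => ?_) (h2 ▸ Finset.le_sup (Finset.mem_univ i₀))
  rcases eq_or_ne i i₀ with rfl | hi
  · exact h2.le
  · rw [h1 i hi]
    norm_num

theorem count_two_eq_one {μ : AtomicMeasure} {i₀ : Fin μ.N} (h2 : μ.size i₀ = 2)
    (h1 : ∀ i, i ≠ i₀ → μ.size i = 1) : μ.count 2 = 1 := by
  refine Finset.card_eq_one.2 ⟨i₀, ?_⟩
  ext i
  simp only [Finset.mem_filter, Finset.mem_univ, true_and, Finset.mem_singleton]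
  refine ⟨fun h => by_contra fun hi => ?_, fun h => h ▸ h2⟩
  have := h1 i hi
  omega

theorem count_one_add_one {μ : AtomicMeasure} {i₀ : Fin μ.N} (h2 : μ.size i₀ = 2)
    (h1 : ∀ i, i ≠ i₀ → μ.size i = 1) : μ.count 1 + 1 = μ.N := by
  have e : (Finset.univ.filter fun i => μ.size i = 1) = Finset.univ.erase i₀ := by
    ext i
    simp only [Finset.mem_filter, Finset.mem_univ, true_and, Finset.mem_erase, and_true]
    refine ⟨fun h hi => ?_, h1 i⟩
    rw [hi] at h
    omega
  rw [count, e, Finset.card_erase_add_one (Finset.mem_univ _), Finset.card_univ, Fintype.card_fin]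

theorem exists_unique_size_two {μ : AtomicMeasure} (hmax : μ.maxSize = 2) (hcount : μ.count 2 = 1) :
    ∃ i₀, μ.size i₀ = 2 ∧ ∀ i, i ≠ i₀ → μ.size i = 1 := by
  obtain ⟨i₀, h⟩ := Finset.card_eq_one.1 hcount
  have hmem : ∀ i, μ.size i = 2 ↔ i = i₀ := fun i => by
    simpa using Finset.ext_iff.1 h i
  refine ⟨i₀, (hmem i₀).2 rfl, fun i hi => ?_⟩
  have h3 : μ.size i ≤ μ.maxSize := Finset.le_sup (Finset.mem_univ i)
  have h4 := μ.size_pos i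
  have h5 := mt (hmem i).1 hi
  omega

variable {μ : AtomicMeasure} {β : TracialSequence}

/-- Atoms of size 1 have A = 0 and contribute nothing to β_{X²}. -/
theorem Represents.exists_one_lt_size (h : μ.Represents β) (hβ : β.IsAnticommuting)
    (hXX : β.moment [.X, .X] ≠ 0) : ∃ i, 1 < μ.size i := by
  by_contra! hs
  refine hXX ?_
  rw [h]
  refine Finset.sum_eq_zero fun i _ => ?_
  have h1 : μ.size i = 1 := le_antisymm (hs i) (μ.size_pos i)
  rw [evalWord_cons_X,
    (exists_normal_form_of_size_one h1 (h.anticommute hβ i) (h.B_mul_B hβ i)).1]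
  simp

/-- The data of a representing measure with one atom of size `2` and all others of size `1`. -/
theorem Represents.exists_normal_form (h : μ.Represents β) (hβ : β.IsAnticommuting)
    (hXX : β.moment [.X, .X] ≠ 0) {i₀ : Fin μ.N} (h2 : μ.size i₀ = 2)
    (h1 : ∀ i, i ≠ i₀ → μ.size i = 1) :
    (∑ i ∈ Finset.univ.erase i₀, μ.density i * (μ.B i).trace = β.moment [.Y]) ∧
    ∃ x : ℝ, 0 < x ∧ μ.density i₀ * x ^ 2 = β.moment [.X, .X] ∧
      μ.density i₀ * x ^ 4 = β.moment [.X, .X, .X, .X] ∧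
      ∃ U : Matrix (Fin (μ.size i₀)) (Fin 2) ℝ,
        U * Uᵀ = 1 ∧ Uᵀ * U = 1 ∧ μ.A i₀ = U * flip x * Uᵀ ∧ μ.B i₀ = U * signs * Uᵀ := by
  have hA : ∀ i, i ≠ i₀ → μ.A i = 0 := fun i hi =>
    (exists_normal_form_of_size_one (h1 i hi) (h.anticommute hβ i) (h.B_mul_B hβ i)).1
  have hs : (μ.size i₀ : ℝ) = 2 := by exact_mod_cast h2
  have split : ∀ (w : List Letter) (hw : w.length ≤ 4), β.moment w hw =
      μ.density i₀ * (1 / 2 * (evalWord (μ.A i₀) (μ.B i₀) w).trace) +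
      ∑ i ∈ Finset.univ.erase i₀, μ.density i * (evalWord (μ.A i) (μ.B i) w).trace := by
    intro w hw
    rw [h w hw, ← Finset.add_sum_erase _ _ (Finset.mem_univ i₀), hs]
    congr 1
    refine Finset.sum_congr rfl fun i hi => ?_
    have : (μ.size i : ℝ) = 1 := by exact_mod_cast h1 i (Finset.ne_of_mem_erase hi)
    rw [this, div_one, one_mul]
  -- Words starting with X see only the atom of size 2, since A = 0 at all the others.
  have split' : ∀ (w : List Letter) (hw : (Letter.X :: w).length ≤ 4), β.moment (.X :: w) hw =
      μ.density i₀ * (1 / 2 * (evalWord (μ.A i₀) (μ.B i₀) (.X :: w)).trace) := by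
    intro w hw
    rw [split, add_eq_left]
    refine Finset.sum_eq_zero fun i hi => ?_
    rw [evalWord_cons_X, hA i (Finset.ne_of_mem_erase hi)]
    simp
  have hA0 : μ.A i₀ ≠ 0 := by
    intro h0
    refine hXX ?_
    rw [split', evalWord_cons_X, h0]
    simp
  obtain ⟨x, hx, U, hU, hU', hAU, hBU⟩ := exists_normal_form_of_size_two h2 (μ.A_symm i₀)
    (μ.B_symm i₀) (h.anticommute hβ i₀) (h.B_mul_B hβ i₀) hA0
  refine ⟨?_, x, hx, ?_, ?_, U, hU, hU', hAU, hBU⟩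
  · rw [split [.Y], hAU, hBU, trace_evalWord_conj hU hU', trace_evalWord_flip_signs _ _ (by simp)]
    simp [reducedMoment, evalWord_cons_Y, evalWord_nil]
  · rw [split', hAU, hBU, trace_evalWord_conj hU hU', trace_evalWord_flip_signs _ _ (by simp)]
    simp [reducedMoment]
  · rw [split', hAU, hBU, trace_evalWord_conj hU hU', trace_evalWord_flip_signs _ _ (by simp)]
    simp [reducedMoment]

end AtomicMeasure

/-! ### Uniqueness of the minimal measure -/

/-- The parameters of a canonical measure that represents `β`. -/
structure CanonicalData (β : TracialSequence) (n : ℕ) where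
  x : ℝ
  l : ℝ
  α : Fin n → ℝ
  ε : Fin n → ℝ
  x_pos : 0 < x
  l_pos : 0 < l
  α_pos : ∀ j, 0 < α j
  sum_eq : l + ∑ j, α j = 1
  ε_mul_self : ∀ j, ε j * ε j = 1
  ε_injective : Function.Injective ε
  -- As ε_j ε_k = -1 for k ≠ j, the sum of α_k (1 + ε_j ε_k) over k is 2α_j; it also equals 1 - l +
  -- ε_j β_Y.
  α_eq : ∀ j, α j = (1 - l + ε j * β.moment [.Y]) / 2
  moment_Y : ∑ j, α j * ε j = β.moment [.Y]
  moment_XX : l * x ^ 2 = β.moment [.X, .X]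
  moment_XXX : β.moment [.X, .X, .X] = 0
  moment_XXXX : l * x ^ 4 = β.moment [.X, .X, .X, .X]

namespace CanonicalData

variable {β : TracialSequence} {n : ℕ}

/-- The canonical measure with the given parameters. -/
noncomputable def measure (D : CanonicalData β n) : AtomicMeasure :=
  canonicalMeasure n D.x D.l D.α D.ε D.l_pos D.α_pos D.sum_eq

theorem represents (D : CanonicalData β n) (hβ : β.IsAnticommuting) : D.measure.Represents β :=
  canonicalMeasure_represents hβ D.l_pos D.α_pos D.sum_eq D.ε_mul_self D.moment_Y D.moment_XX
    D.moment_XXX D.moment_XXXX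

theorem size_of_ne_zero (D : CanonicalData β n) (i : Fin (n + 1)) :
    i ≠ 0 → D.measure.size i = 1 := by
  refine Fin.cases (fun h => absurd rfl h) (fun j _ => rfl) i

theorem maxSize_measure (D : CanonicalData β n) : D.measure.maxSize = 2 :=
  AtomicMeasure.maxSize_eq_two (μ := D.measure) (i₀ := (0 : Fin (n + 1))) rfl D.size_of_ne_zero

theorem count_two_measure (D : CanonicalData β n) : D.measure.count 2 = 1 :=
  AtomicMeasure.count_two_eq_one (μ := D.measure) (i₀ := (0 : Fin (n + 1))) rfl D.size_of_ne_zero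

theorem count_one_measure (D : CanonicalData β n) : D.measure.count 1 = n :=
  Nat.add_right_cancel (AtomicMeasure.count_one_add_one (μ := D.measure) (i₀ := (0 : Fin (n + 1)))
    rfl D.size_of_ne_zero)

theorem moment_XX_ne_zero (D : CanonicalData β n) : β.moment [.X, .X] ≠ 0 := by
  have := D.l_pos
  have := D.x_pos
  rw [← D.moment_XX]
  positivity

theorem ε_mul_ε_of_ne (D : CanonicalData β n) {j k : Fin n} (h : j ≠ k) : D.ε j * D.ε k = -1 := by
  have hne := D.ε_injective.ne h
  rcases mul_self_eq_one_iff.1 (D.ε_mul_self j) with hj | hj <;>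
    rcases mul_self_eq_one_iff.1 (D.ε_mul_self k) with hk | hk <;>
    simp_all

variable {ν : AtomicMeasure}

/-- The quotient of the two moments determines x², and then either of them determines l. -/
theorem eq_parameters (D : CanonicalData β n) {l x : ℝ} (hl : 0 < l) (hx : 0 < x) (h2 :
    l * x ^ 2 = β.moment [.X, .X])
    (h4 : l * x ^ 4 = β.moment [.X, .X, .X, .X]) : x = D.x ∧ l = D.l := by
  have hx' := D.x_pos
  have hl' := D.l_pos
  rw [← D.moment_XX] at h2
  rw [← D.moment_XXXX] at h4
  have hsq : x ^ 2 = D.x ^ 2 := by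
    have : l * x ^ 2 * (x ^ 2 - D.x ^ 2) = 0 := by linear_combination h4 - D.x ^ 2 * h2
    have hne : l * x ^ 2 ≠ 0 := by positivity
    linarith [(mul_eq_zero.1 this).resolve_left hne]
  refine ⟨(pow_left_inj₀ hx.le hx'.le two_ne_zero).1 hsq, ?_⟩
  rw [hsq] at h2
  exact mul_right_cancel₀ (by positivity) h2

/-- Each atom of size `1` of the canonical measure has a counterpart in any representing measure
with a single atom of size `2` and no larger ones. -/
theorem exists_matching (D : CanonicalData β n) (hβ : β.IsAnticommuting) (h : ν.Represents β)
    {i₀ : Fin ν.N}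
    (h2 : ν.size i₀ = 2) (h1 : ∀ i, i ≠ i₀ → ν.size i = 1) :
    ∃ f : Fin n → Fin ν.N, Function.Injective f ∧ ∀ j, f j ≠ i₀ ∧ (ν.B (f j)).trace = D.ε j := by
  obtain ⟨hY, x, hx, hXX, hXXXX, -⟩ := h.exists_normal_form hβ D.moment_XX_ne_zero h2 h1
  obtain ⟨-, hl⟩ := D.eq_parameters (ν.density_pos i₀) hx hXX hXXXX
  have hsum := ν.density_sum
  rw [← Finset.add_sum_erase _ _ (Finset.mem_univ i₀), hl] at hsum
  have key : ∀ j, ∃ i, i ≠ i₀ ∧ (ν.B i).trace = D.ε j := by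
    intro j
    by_contra! hno
    -- If the sign ε_j is missing among the atoms of size 1, every factor 1 + ε_j tr B vanishes; but
    -- the sum is 2α_j > 0.
    have hzero : ∑ i ∈ Finset.univ.erase i₀, ν.density i * (1 + D.ε j * (ν.B i).trace) = 0 := by
      refine Finset.sum_eq_zero fun i hi => ?_
      have hi' := Finset.ne_of_mem_erase hi
      have hne := hno i hi'
      have hpm := (exists_normal_form_of_size_one (h1 i hi') (h.anticommute hβ i)
        (h.B_mul_B hβ i)).2.1
      have hneg : D.ε j * (ν.B i).trace = -1 := by
        rcases mul_self_eq_one_iff.1 (D.ε_mul_self j) with hj | hj <;>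
          rcases hpm with hk | hk <;> simp_all
      rw [hneg]
      ring
    have hα := D.α_pos j
    have : ∑ i ∈ Finset.univ.erase i₀, ν.density i * (1 + D.ε j * (ν.B i).trace) = 2 * D.α j := by
      rw [D.α_eq j, ← hY]
      simp only [mul_add, mul_one, Finset.sum_add_distrib]
      have e : ∑ i ∈ Finset.univ.erase i₀, ν.density i * (D.ε j * (ν.B i).trace) =
          D.ε j * ∑ i ∈ Finset.univ.erase i₀, ν.density i * (ν.B i).trace := by
        rw [Finset.mul_sum]
        exact Finset.sum_congr rfl fun i _ => by ring
      rw [e]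
      linarith
    linarith
  choose f hf hf' using key
  refine ⟨f, fun j k hjk => D.ε_injective ?_, fun j => ⟨hf j, hf' j⟩⟩
  rw [← hf' j, ← hf' k, hjk]

theorem le_count_one (D : CanonicalData β n) (hβ : β.IsAnticommuting) (h : ν.Represents β)
    (hmax : ν.maxSize = 2)
    (hcount : ν.count 2 = 1) : n ≤ ν.count 1 := by
  obtain ⟨i₀, h2, h1⟩ := AtomicMeasure.exists_unique_size_two hmax hcount
  obtain ⟨f, hf, hf'⟩ := D.exists_matching hβ h h2 h1
  calc n = (Finset.univ.image f).card := by
        rw [Finset.card_image_of_injective _ hf, Finset.card_univ, Fintype.card_fin]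
    _ ≤ ν.count 1 := Finset.card_le_card fun i hi => by
        obtain ⟨j, -, rfl⟩ := Finset.mem_image.1 hi
        simpa using h1 _ (hf' j).1

theorem two_le_maxSize (D : CanonicalData β n) (hβ : β.IsAnticommuting) (h : ν.Represents β) :
    2 ≤ ν.maxSize := by
  obtain ⟨i, hi⟩ := h.exists_one_lt_size hβ D.moment_XX_ne_zero
  exact Nat.succ_le_of_lt (hi.trans_le (Finset.le_sup (f := ν.size) (Finset.mem_univ i)))

theorem one_le_count_two (D : CanonicalData β n) (hβ : β.IsAnticommuting) (h : ν.Represents β)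
    (hmax : ν.maxSize = 2) :
    1 ≤ ν.count 2 := by
  obtain ⟨i, hi⟩ := h.exists_one_lt_size hβ D.moment_XX_ne_zero
  have hle : ν.size i ≤ ν.maxSize := Finset.le_sup (Finset.mem_univ i)
  exact Finset.card_pos.2 ⟨i, by simp; omega⟩

theorem isMinimal (D : CanonicalData β n) (hβ : β.IsAnticommuting) : D.measure.IsMinimal β := by
  refine ⟨D.represents hβ, fun ν h hsm => ?_⟩
  have hge := D.two_le_maxSize hβ h
  rcases hsm with hlt | ⟨hmax, k, hk1, hk2, hlt, hagree⟩
  · rw [D.maxSize_measure] at hlt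
    omega
  · rw [D.maxSize_measure] at hmax
    rw [hmax] at hk2 hagree
    have hc2 := D.one_le_count_two hβ h hmax
    interval_cases k
    · have h21 := hagree 2 (by norm_num) le_rfl
      rw [D.count_two_measure] at h21
      rw [D.count_one_measure] at hlt
      have := D.le_count_one hβ h hmax h21
      omega
    · rw [D.count_two_measure] at hlt
      omega

/-- The canonical measure competes with ν, so ν cannot exceed it in size or counts; the lower bounds
valid for every representing measure give equality. -/
theorem type_of_isMinimal (D : CanonicalData β n) (hβ : β.IsAnticommuting) (h : ν.IsMinimal β) :
    ν.maxSize = 2 ∧ ν.count 2 = 1 ∧ ν.count 1 = n := by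
  have hns := h.2 D.measure (D.represents hβ)
  simp only [AtomicMeasure.SmallerType, not_or, not_lt, not_and, not_exists] at hns
  obtain ⟨hle, hns⟩ := hns
  rw [D.maxSize_measure] at hle hns
  have hmax : ν.maxSize = 2 := le_antisymm hle (D.two_le_maxSize hβ h.1)
  have hns' := hns hmax.symm
  have hc2 := D.one_le_count_two hβ h.1 hmax
  have h2 : ν.count 2 = 1 := by
    by_contra hne
    refine hns' 2 (by norm_num) le_rfl ?_ fun j hj hj' => absurd hj (not_lt.2 hj')
    rw [D.count_two_measure]
    omega
  refine ⟨hmax, h2, ?_⟩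
  have hc1 := D.le_count_one hβ h.1 hmax h2
  by_contra hne
  refine hns' 1 le_rfl (by norm_num) ?_ fun j hj hj' => ?_
  · rw [D.count_one_measure]
    omega
  · obtain rfl : j = 2 := by omega
    rw [D.count_two_measure, h2]

theorem hasType_of_isMinimal (D : CanonicalData β n) (hβ : β.IsAnticommuting) (h :
    ν.IsMinimal β) : ν.HasType [n, 1] := by
  obtain ⟨hmax, h2, h1⟩ := D.type_of_isMinimal hβ h
  refine ⟨hmax.symm, fun k hk => ?_⟩
  have : k < 2 := hk
  interval_cases k
  · exact h1
  · exact h2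

theorem orthogonallyEquivalent (D : CanonicalData β n) (hβ : β.IsAnticommuting) (h :
    ν.IsMinimal β) :
    D.measure.OrthogonallyEquivalent ν := by
  obtain ⟨hmax, hc2, hc1⟩ := D.type_of_isMinimal hβ h
  obtain ⟨i₀, h2, h1⟩ := AtomicMeasure.exists_unique_size_two hmax hc2
  obtain ⟨f, hf, hf'⟩ := D.exists_matching hβ h.1 h2 h1
  obtain ⟨hY, x, hx, hXX, hXXXX, U, hU, hU', hAU, hBU⟩ :=
    h.1.exists_normal_form hβ D.moment_XX_ne_zero h2 h1
  obtain ⟨rfl, hl⟩ := D.eq_parameters (ν.density_pos i₀) hx hXX hXXXX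
  have hN : ν.N = n + 1 := by rw [← AtomicMeasure.count_one_add_one h2 h1, hc1]
  have hinj : Function.Injective (Fin.cases i₀ f : Fin (n + 1) → Fin ν.N) := by
    intro a b
    refine Fin.cases ?_ (fun j => ?_) a <;> refine Fin.cases ?_ (fun k => ?_) b <;> intro hab
    · rfl
    · exact absurd hab.symm (hf' k).1
    · exact absurd hab (hf' j).1
    · exact congrArg Fin.succ (hf hab)
  -- Minimality leaves exactly n atoms of size 1, so the injective matching exhausts all atoms.
  have hbij : Function.Bijective (Fin.cases i₀ f : Fin (n + 1) → Fin ν.N) :=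
    (Fintype.bijective_iff_injective_and_card _).2 ⟨hinj, by simp [hN]⟩
  have himage : Finset.univ.erase i₀ = Finset.univ.image f := by
    ext i
    obtain ⟨a, rfl⟩ := hbij.2 i
    refine Fin.cases ?_ (fun j => ?_) a
    · simpa using fun j => (hf' j).1
    · simpa using (hf' j).1
  have hsum := ν.density_sum
  rw [← Finset.add_sum_erase _ _ (Finset.mem_univ i₀), hl, himage,
    Finset.sum_image hf.injOn] at hsum
  rw [himage, Finset.sum_image hf.injOn] at hY
  have hdens : ∀ j, D.α j = ν.density (f j) := by
    intro j
    -- The factor 1 + ε_j ε_k is 2 for k = j and 0 otherwise, which isolates the density of one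
    -- atom.
    have e : ∑ k, ν.density (f k) * (1 + D.ε j * D.ε k) = ν.density (f j) * 2 := by
      rw [Finset.sum_eq_single j, D.ε_mul_self]
      · ring
      · intro k _ hk
        rw [D.ε_mul_ε_of_ne hk.symm]
        ring
      · simp
    have e' : ∑ k, ν.density (f k) * (1 + D.ε j * D.ε k) =
        ∑ k, ν.density (f k) + D.ε j * ∑ k, ν.density (f k) * (ν.B (f k)).trace := by
      rw [Finset.mul_sum, ← Finset.sum_add_distrib]
      exact Finset.sum_congr rfl fun k _ => by rw [(hf' k).2]; ring
    rw [hY] at e'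
    rw [D.α_eq j]
    linarith
  refine ⟨Equiv.ofBijective _ hbij, fun i => ?_⟩
  refine Fin.cases ?_ (fun j => ?_) i
  · exact ⟨h2.symm, hl.symm, U, hU, hU', hAU, hBU⟩
  · obtain ⟨hA, -, V, hV, hV', hBV⟩ := exists_normal_form_of_size_one (h1 _ (hf' j).1)
      (h.1.anticommute hβ (f j)) (h.1.B_mul_B hβ (f j))
    rw [(hf' j).2] at hBV
    refine ⟨(h1 _ (hf' j).1).symm, hdens j, V, hV, hV', ?_, hBV⟩
    change ν.A (f j) = V * (0 : Matrix (Fin 1) (Fin 1) ℝ) * Vᵀ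
    rw [hA, Matrix.mul_zero, Matrix.zero_mul]

theorem hasUniqueMinimalMeasure (D : CanonicalData β n) (hβ : β.IsAnticommuting) :
    β.HasUniqueMinimalMeasure :=
  ⟨D.measure, D.isMinimal hβ, fun _ h => D.orthogonallyEquivalent hβ h⟩

theorem admitsNCMeasure (D : CanonicalData β n) (hβ : β.IsAnticommuting) : β.AdmitsNCMeasure :=
  ⟨D.measure, D.isMinimal hβ, by rw [D.maxSize_measure]; norm_num⟩

end CanonicalData

/-! ### Existence of the canonical measure -/

/-- With the next lemma: l = c²/e and x = √(e/c) solve l x² = c and l x⁴ = e. -/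
theorem sq_div_mul_sqrt_pow_two {c e : ℝ} (hc : 0 < c) (he : 0 < e) :
    c ^ 2 / e * √(e / c) ^ 2 = c := by
  rw [Real.sq_sqrt (by positivity)]
  field_simp

theorem sq_div_mul_sqrt_pow_four {c e : ℝ} (hc : 0 < c) (he : 0 < e) :
    c ^ 2 / e * √(e / c) ^ 4 = e := by
  rw [show √(e / c) ^ 4 = (√(e / c) ^ 2) ^ 2 by ring, Real.sq_sqrt (by positivity)]
  field_simp

/-- The canonical measure with two atoms of size `1`. -/
noncomputable def canonicalDataTwo {β : TracialSequence} (hXX : 0 < β.moment [.X, .X])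
    (he : 0 < β.moment [.X, .X, .X, .X]) (hXXX : β.moment [.X, .X, .X] = 0)
    (hlt : β.moment [.X, .X] ^ 2 / β.moment [.X, .X, .X, .X] < 1 - |β.moment [.Y]|) :
    CanonicalData β 2 where
  x := √(β.moment [.X, .X, .X, .X] / β.moment [.X, .X])
  l := β.moment [.X, .X] ^ 2 / β.moment [.X, .X, .X, .X]
  α := fun j => (1 - β.moment [.X, .X] ^ 2 / β.moment [.X, .X, .X, .X] +
    (![1, -1] : Fin 2 → ℝ) j * β.moment [.Y]) / 2
  ε := ![1, -1]
  x_pos := by positivity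
  l_pos := by positivity
  α_pos := by
    have h1 := le_abs_self (β.moment [.Y])
    have h2 := neg_abs_le (β.moment [.Y])
    intro j
    fin_cases j <;> simp only [Fin.zero_eta, Fin.mk_one, Matrix.cons_val] <;> linarith
  sum_eq := by
    simp only [Fin.sum_univ_two, Matrix.cons_val]
    ring
  ε_mul_self := by
    intro j
    fin_cases j <;> simp
  ε_injective := by
    intro j k
    fin_cases j <;> fin_cases k <;> simp <;> norm_num
  α_eq := fun _ => rfl
  moment_Y := by
    simp only [Fin.sum_univ_two, Matrix.cons_val]
    ring
  moment_XX := sq_div_mul_sqrt_pow_two hXX he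
  moment_XXX := hXXX
  moment_XXXX := sq_div_mul_sqrt_pow_four hXX he

/-- The canonical measure with one atom of size `1`. -/
noncomputable def canonicalDataOne {β : TracialSequence} (hXX : 0 < β.moment [.X, .X])
    (he : 0 < β.moment [.X, .X, .X, .X]) (hXXX : β.moment [.X, .X, .X] = 0)
    (hY : β.moment [.Y] ≠ 0)
    (heq : β.moment [.X, .X] ^ 2 / β.moment [.X, .X, .X, .X] = 1 - |β.moment [.Y]|) :
    CanonicalData β 1 where
  x := √(β.moment [.X, .X, .X, .X] / β.moment [.X, .X])
  l := β.moment [.X, .X] ^ 2 / β.moment [.X, .X, .X, .X]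
  α := fun _ => |β.moment [.Y]|
  -- The sign of β_Y.
  ε := fun _ => β.moment [.Y] / |β.moment [.Y]|
  x_pos := by positivity
  l_pos := by positivity
  α_pos := fun _ => abs_pos.2 hY
  sum_eq := by
    rw [heq]
    simp
  ε_mul_self := fun _ => by
    have := abs_ne_zero.2 hY
    field_simp
    exact (sq_abs _).symm
  ε_injective := Function.injective_of_subsingleton _
  α_eq := fun _ => by
    have := abs_ne_zero.2 hY
    rw [heq]
    field_simp
    linear_combination sq_abs (β.moment [.Y])
  moment_Y := by
    have := abs_ne_zero.2 hY
    simp only [Finset.univ_unique, Finset.sum_const, Finset.card_singleton, one_smul]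
    field_simp
  moment_XX := sq_div_mul_sqrt_pow_two hXX he
  moment_XXX := hXXX
  moment_XXXX := sq_div_mul_sqrt_pow_four hXX he

/-! ### Positivity and rank of the moment matrix -/

namespace TracialSequence

variable {β : TracialSequence}

theorem moment_XX_nonneg (h : β.momentMatrix.PosSemidef) : 0 ≤ β.moment [.X, .X] :=
  h.diag_nonneg (i := 1)

theorem IsAnticommuting.moment_XX_ne_zero (hβ : β.IsAnticommuting) (hnc : β.IsNoncommutative) :
    β.moment [.X, .X] ≠ 0 := by
  intro h0
  refine hnc ?_
  rw [hβ.moment_eq [.X, .X, .Y, .Y], hβ.moment_eq [.X, .Y, .X, .Y]]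
  simp [reducedMoment, h0]

theorem IsAnticommuting.sq_moment_XX_le (hβ : β.IsAnticommuting)
    (h : β.momentMatrix.PosSemidef) : β.moment [.X, .X] ^ 2 ≤ β.moment [.X, .X, .X, .X] := by
  -- The coefficient vector of X² - β_{X²}, at which the quadratic form is β_{X⁴} - β_{X²}².
  have h1 := h.dotProduct_mulVec_nonneg ![-β.moment [.X, .X], 0, 0, 1, 0, 0, 0]
  have hn : β.moment [] = 1 := hβ.norm
  simp [dotProduct, Matrix.mulVec, Fin.sum_univ_succ, momentMatrix, column, wordsTwo, hn] at h1
  linarith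

/-- If `β_{X³} = β_Y = 0` and `β_{X⁴} = β_{X²}²`, then `X² = β_{X²} 1` in the column space. -/
theorem IsAnticommuting.rank_le_four (hβ : β.IsAnticommuting) (hXXX : β.moment [.X, .X, .X] = 0)
    (hY : β.moment [.Y] = 0) (he : β.moment [.X, .X, .X, .X] = β.moment [.X, .X] ^ 2) :
    β.momentMatrix.rank ≤ 4 := by
  have hXX : β.column [.X, .X] = β.moment [.X, .X] • β.column [] := by
    funext i
    simp only [column, Pi.smul_apply, smul_eq_mul]
    rw [hβ.moment_eq ((wordsTwo i).reverse ++ [Letter.X, Letter.X]),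
      hβ.moment_eq ((wordsTwo i).reverse ++ [])]
    fin_cases i <;> simp [wordsTwo, reducedMoment, he, hXXX, hY, sq]
  have hYX : β.column [.Y, .X] = -β.column [.X, .Y] := by
    rw [eq_neg_iff_add_eq_zero, add_comm]
    exact hβ.xy
  classical
  let S : Finset (Fin 7 → ℝ) :=
    {β.column [], β.column [.X], β.column [.Y], β.column [.X, .Y]}
  have mem : ∀ v ∈ S, v ∈ Submodule.span ℝ (S : Set (Fin 7 → ℝ)) := fun v hv =>
    Submodule.subset_span (by exact_mod_cast hv)
  have hsub : Submodule.span ℝ (Set.range β.momentMatrix.col) ≤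
      Submodule.span ℝ (S : Set (Fin 7 → ℝ)) := by
    rw [Submodule.span_le]
    rintro _ ⟨j, rfl⟩
    change β.column (wordsTwo j) (length_wordsTwo_le j) ∈ Submodule.span ℝ (S : Set (Fin 7 → ℝ))
    fin_cases j
    · exact mem (β.column []) (by simp [S])
    · exact mem (β.column [.X]) (by simp [S])
    · exact mem (β.column [.Y]) (by simp [S])
    · change β.column [.X, .X] ∈ _
      rw [hXX]
      exact Submodule.smul_mem _ _ (mem _ (by simp [S]))
    · exact mem (β.column [.X, .Y]) (by simp [S])
    · change β.column [.Y, .X] ∈ _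
      rw [hYX]
      exact Submodule.neg_mem _ (mem _ (by simp [S]))
    · change β.column [.Y, .Y] ∈ _
      rw [hβ.yy]
      exact mem _ (by simp [S])
  calc β.momentMatrix.rank
      = Module.finrank ℝ (Submodule.span ℝ (Set.range β.momentMatrix.col)) :=
        Matrix.rank_eq_finrank_span_cols _
    _ ≤ Module.finrank ℝ (Submodule.span ℝ (S : Set (Fin 7 → ℝ))) := Submodule.finrank_mono hsub
    _ ≤ S.card := finrank_span_finset_le_card S
    _ ≤ 4 := Finset.card_le_four

end TracialSequence

theorem AtomicMeasure.HasType.head_eq {μ : AtomicMeasure} {m n k l : ℕ} (h : μ.HasType [m, k])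
    (h' : μ.HasType [n, l]) : m = n :=
  (h.2 0 (by simp)).symm.trans (h'.2 0 (by simp))

end TracialMoment

/-! ### The characterization and the types of the minimal measures -/

theorem theorem6p7 (β : TracialMoment.TracialSequence)
    (hnorm : β.IsNormalized) (hnc : β.IsNoncommutative)
    (hrank : β.momentMatrix.rank = 5)
    (hXY : β.column [.X, .Y] + β.column [.Y, .X] = 0)
    (hYY : β.column [.Y, .Y] = β.column []) :
    (β.AdmitsNCMeasure ↔
      (β.momentMatrix.PosSemidef ∧ β.moment [.X, .X, .X] = 0 ∧ β.moment [.Y] = 0) ∨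
      (β.momentMatrix.PosSemidef ∧ β.MomentConditions)) ∧
    (β.momentMatrix.PosSemidef → β.moment [.X, .X, .X] = 0 → β.moment [.Y] = 0 →
      β.HasUniqueMinimalMeasure ∧
        ∀ μ : TracialMoment.AtomicMeasure, μ.IsMinimal β → μ.HasType [2, 1]) ∧
    (β.MomentConditions →
      β.HasUniqueMinimalMeasure ∧
        ∀ μ : TracialMoment.AtomicMeasure, μ.IsMinimal β →
          (μ.HasType [1, 1] ↔
            β.moment [.X, .X, .X, .X] = β.moment [.X, .X] ^ 2 / (1 - |β.moment [.Y]|)) ∧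
          (β.moment [.X, .X, .X, .X] ≠ β.moment [.X, .X] ^ 2 / (1 - |β.moment [.Y]|) →
            μ.HasType [2, 1])) := by
  have hβ : β.IsAnticommuting := ⟨hnorm, hXY, hYY⟩
  have hne := hβ.moment_XX_ne_zero hnc
  have case1 : β.momentMatrix.PosSemidef → β.moment [.X, .X, .X] = 0 → β.moment [.Y] = 0 →
      Nonempty (TracialMoment.CanonicalData β 2) := by
    intro hpsd hXXX hY
    have hXX := lt_of_le_of_ne (TracialMoment.TracialSequence.moment_XX_nonneg hpsd) hne.symm
    -- Positivity gives the weak inequality; rank 5 rules out equality.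
    have hlt : β.moment [.X, .X] ^ 2 < β.moment [.X, .X, .X, .X] :=
      lt_of_le_of_ne (hβ.sq_moment_XX_le hpsd) fun he => by
        have := hβ.rank_le_four hXXX hY he.symm
        omega
    have he : 0 < β.moment [.X, .X, .X, .X] := (by positivity : (0 : ℝ) < _).trans hlt
    refine ⟨TracialMoment.canonicalDataTwo hXX he hXXX ?_⟩
    rw [hY, abs_zero, sub_zero, div_lt_one he]
    exact hlt
  have case2 : β.MomentConditions →
      (β.moment [.X, .X, .X, .X] = β.moment [.X, .X] ^ 2 / (1 - |β.moment [.Y]|) ∧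
        Nonempty (TracialMoment.CanonicalData β 1)) ∨
      (β.moment [.X, .X, .X, .X] ≠ β.moment [.X, .X] ^ 2 / (1 - |β.moment [.Y]|) ∧
        Nonempty (TracialMoment.CanonicalData β 2)) := by
    rintro ⟨hXXX, hXX, hY, hY1, hle⟩
    have hpos : 0 < 1 - |β.moment [.Y]| := by linarith
    have he : 0 < β.moment [.X, .X, .X, .X] := (by positivity : (0 : ℝ) < _).trans_le hle
    rcases hle.eq_or_lt with heq | hlt
    · refine Or.inl ⟨heq.symm, ⟨TracialMoment.canonicalDataOne hXX he hXXX (abs_pos.1 hY) ?_⟩⟩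
      rw [div_eq_iff hpos.ne'] at heq
      rw [div_eq_iff he.ne', heq, mul_comm]
    · refine Or.inr ⟨hlt.ne', ⟨TracialMoment.canonicalDataTwo hXX he hXXX ?_⟩⟩
      rw [div_lt_iff₀ hpos] at hlt
      rwa [div_lt_iff₀ he, mul_comm]
  refine ⟨⟨?_, ?_⟩, ?_, ?_⟩
  · rintro ⟨μ, ⟨hμ, -⟩, -⟩
    have hpsd := hμ.posSemidef
    have hXXX := hμ.moment_XXX_eq_zero hβ
    by_cases hY : β.moment [.Y] = 0
    · exact Or.inl ⟨hpsd, hXXX, hY⟩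
    · have hXX := lt_of_le_of_ne (TracialMoment.TracialSequence.moment_XX_nonneg hpsd) hne.symm
      have hsq := hμ.sq_moment_le hβ
      have he : 0 ≤ β.moment [.X, .X, .X, .X] :=
        (sq_nonneg _).trans (hβ.sq_moment_XX_le hpsd)
      -- 0 < β_{X²}² ≤ β_{X⁴}(1 - |β_Y|) with β_{X⁴} ≥ 0 forces |β_Y| < 1.
      have hpos : 0 < 1 - |β.moment [.Y]| :=
        pos_of_mul_pos_right ((by positivity : (0 : ℝ) < _).trans_le hsq) he
      refine Or.inr ⟨hpsd, hXXX, hXX, abs_pos.2 hY, by linarith, ?_⟩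
      rwa [div_le_iff₀ hpos]
  · rintro (⟨hpsd, hXXX, hY⟩ | ⟨-, hm⟩)
    · obtain ⟨D⟩ := case1 hpsd hXXX hY
      exact D.admitsNCMeasure hβ
    · rcases case2 hm with ⟨-, ⟨D⟩⟩ | ⟨-, ⟨D⟩⟩ <;> exact D.admitsNCMeasure hβ
  · intro hpsd hXXX hY
    obtain ⟨D⟩ := case1 hpsd hXXX hY
    exact ⟨D.hasUniqueMinimalMeasure hβ, fun μ hμ => D.hasType_of_isMinimal hβ hμ⟩
  · intro hm
    rcases case2 hm with ⟨heq, ⟨D⟩⟩ | ⟨hneq, ⟨D⟩⟩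
    · exact ⟨D.hasUniqueMinimalMeasure hβ, fun μ hμ =>
        ⟨⟨fun _ => heq, fun _ => D.hasType_of_isMinimal hβ hμ⟩, fun h => absurd heq h⟩⟩
    · refine ⟨D.hasUniqueMinimalMeasure hβ, fun μ hμ => ?_⟩
      have ht := D.hasType_of_isMinimal hβ hμ
      exact ⟨⟨fun h => absurd (h.head_eq ht) (by norm_num), fun h => absurd h hneq⟩, fun _ => ht⟩
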